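/- **Setting.** Let $(X,Y)$ have law $\mathcal Q$ on $\mathbb R^d\times\mathbb R$ with $Y=g^*(X)+Z$, where $g^*$ is measurable, $\mathbb E[Z]=0$, $\mathbb V(Z)=\sigma^2<\infty$, $Z$ is independent of $X$, and $Y$ is bounded. Let $D_n=((X_1,Y_1),\dots,(X_n,Y_n))$ be the first $n$ terms of an i.i.d. sequence with law $\mathcal Q$ on a probability space $(\Omega,\mathcal A,\mathbb P)$. For $r\subseteq\mathbb R^d$ put $\mathcal Q_n(r)=\frac1n\#\{i\le n:X_i\in r\}$, $\mathbb E_n[Y]=\frac1n\sum_i Y_i$, and, when $\mathcal Q_n(r)>0$, $\mathbb E_n[h(Y)\mid X\in r]=\sum_i h(Y_i)\mathbf 1_{X_i\in r}/\sum_i\mathbf 1_{X_i\in r}$ and $\mathbb V_n(Y\mid X\in r)=\mathbb E_n[Y^2\mid X\in r]-\mathbb E_n[Y\mid X\in r]^2$. The notation $o_{\mathbb P}(1)$ means convergence to $0$ in (outer) probability, and statements about the random collections below are meant almost surely. **Suitability.** Let $\alpha\in[0,1/2)$. A sequence $\mathcal C_n=\mathcal C_n(D_n)$, $n\ge1$,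 of data-dependent finite collections of subsets of $\mathbb R^d$ is *$\alpha$-suitable* for the variance estimator $\sigma_n^2=\sigma_n^2(D_n)$ if $\sigma_n^2-\sigma^2=o_{\mathbb P}(1)$ and 1. (set coverage) $\mathcal Q_n(r)>n^{-\alpha}$ for all $r\in\mathcal C_n$ and $n\ge2$; 2. (collection coverage) $\mathcal Q_n\big(\mathbb R^d\setminus\bigcup_{r\in\mathcal C_n}r\big)=o_{\mathbb P}(1)$; 3. (significance) there are random sequences $\beta_n=o_{\mathbb P}(1)$ and $\varepsilon_n=o_{\mathbb P}(1)$ with $\mathcal C_n=\mathcal C_n^s\cup\mathcal C_n^i$ for all $n\ge1$, where $$\mathcal C_n^s=\Big\{r\in\mathcal C_n:\beta_n\big|\mathbb E_n[Y\mid X\in r]-\mathbb E_n[Y]\big|\ge\sqrt{(\mathbb V_n(Y\mid X\in r)-\sigma_n^2)_+}\Big\},$$ $$\mathcal C_n^i=\Big\{r\in\mathcal C_n\setminus\mathcal C_n^s:\varepsilon_n\ge\sqrt{(\mathbb V_n(Y\mid X\in r)-\sigma_n^2)_+}\Big\}$$ are the significant and the insignificant sets; 4. (redundancy) with the same sequences,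 $M(\mathcal C_n^s)/m(\mathcal C_n^s)=o_{\mathbb P}(\beta_n^{-2}\wedge n^{1/2-\alpha})$ and $M(\mathcal C_n^i)/m(\mathcal C_n^i)=o_{\mathbb P}(\varepsilon_n^{-2}\wedge n^{1/2-\alpha})$, where $M(\mathcal C)$ and $m(\mathcal C)$ are the maximum and the minimum over $x\in\bigcup_{r\in\mathcal C}r$ of $\#\{r\in\mathcal C:x\in r\}$ (the ratio being $0$ if this union is empty). **Proposition.** Let $\mathcal X\subseteq\mathbb R^d$ be a Borel set (the feature space) with $\mathbb P(X\in\mathcal X)=1$, and let $\mathcal P_n=\mathcal P_n(D_n)$, where for each $n$ and each $d_n\in(\mathbb R^d\times\mathbb R)^n$, $\mathcal P_n(d_n)$ is a finite partition of $\mathcal X$. Let $\alpha\in[0,1/2)$ and assume: - the set coverage condition 1 holds for $\mathcal C_n=\mathcal P_n$; - the cells form a.s. a $\mathcal Q$-Donsker class: there are sets $G_n\subseteq(\mathbb R^d\times\mathbb R)^n$ with $D_n\in G_n$ a.s. such that $$\bigcup_{n\ge1}\bigcup_{d_n\in G_n}\{r\times\mathbb R:r\in\mathcal P_n(d_n)\}$$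 consists of Borel sets and is a $\mathcal Q$-Donsker class, i.e. the empirical processes $\sqrt n\,(\mathcal Q_n-\mathcal Q)$ of i.i.d. $\mathcal Q$-samples (given by the coordinates of a product probability space), indexed by this class, converge in distribution, in the space $\ell^\infty$ of bounded functions on this class, to a tight limit; - $\sigma^2$ is known; - $g^*$ is uniformly continuous on $\mathcal X$; - $\max_{r\in\mathcal P_n}\sup_{x,x'\in r}\|x-x'\|=o_{\mathbb P}(1)$, where $\|\cdot\|$ is any norm of $\mathbb R^d$. Then $(\mathcal P_n)$ is $\alpha$-suitable for $\sigma_n^2=\sigma^2$; in particular, almost surely every cell is significant or insignificant. -/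

import Mathlib

open MeasureTheory ProbabilityTheory Filter Topology Set
open scoped ENNReal BoundedContinuousFunction

noncomputable section

namespace QuasiCovering

/-! ### Outer expectation and Donsker classes -/

/-- Outer expectation of a bounded (not necessarily measurable) real map `T`: the infimum of the
expectations of the integrable measurable majorants of `T`. -/
def outerExp {Ω : Type*} [MeasurableSpace Ω] (μ : Measure Ω) (T : Ω → ℝ) : ℝ :=
  sInf {x : ℝ | ∃ U : Ω → ℝ, Measurable U ∧ Integrable U μ ∧ (∀ ω, T ω ≤ U ω) ∧ x = ∫ ω, U ω ∂μ}

/-- The Banach space `ℓ^∞(ι)` of bounded real functions on `ι`, with the supremum norm. -/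
abbrev EllInf (ι : Type*) := lp (fun _ : ι => ℝ) ∞

instance instMeasurableSpaceEllInf (ι : Type*) : MeasurableSpace (EllInf ι) := borel _

instance instBorelSpaceEllInf (ι : Type*) : BorelSpace (EllInf ι) := ⟨rfl⟩

/-- The empirical process `v_n f = √n (∫ f dQ_n - ∫ f dQ)`, as a function of the sample `s`. -/
def empProcess {S : Type*} [MeasurableSpace S] (Q : Measure S) (n : ℕ) (s : Fin n → S)
    (f : S → ℝ) : ℝ :=
  Real.sqrt n * ((∑ i, f (s i)) / n - ∫ z, f z ∂Q)

/-- `F` is a `Q`-Donsker class of functions: the empirical processes `(v_n f)_{f ∈ F}`, as maps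
from the canonical sample space `(S^n, Q^n)` to `ℓ^∞(F)`, converge in distribution
(in the sense of outer expectations) to a tight Borel law `ν` on `ℓ^∞(F)`. -/
def IsDonsker {S : Type*} [MeasurableSpace S] (Q : Measure S) [IsProbabilityMeasure Q]
    (F : Set (S → ℝ)) : Prop :=
  (∀ f ∈ F, Integrable f Q) ∧
  ∃ v : ∀ n : ℕ, (Fin n → S) → EllInf F,
    (∀ (n : ℕ) (s : Fin n → S) (f : F), (v n s : F → ℝ) f = empProcess Q n s f) ∧
    ∃ ν : Measure (EllInf F), IsProbabilityMeasure ν ∧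
      (∀ δ : ℝ≥0∞, 0 < δ → ∃ K : Set (EllInf F), IsCompact K ∧ ν Kᶜ ≤ δ) ∧
      ∀ h : EllInf F →ᵇ ℝ,
        Tendsto (fun n : ℕ => outerExp (Measure.pi fun _ : Fin n => Q) (fun s => h (v n s)))
          atTop (𝓝 (∫ z, h z ∂ν))

/-- A class of measurable sets is `Q`-Donsker if the class of its indicator functions is. -/
def IsDonskerSets {S : Type*} [MeasurableSpace S] (Q : Measure S) [IsProbabilityMeasure Q]
    (B : Set (Set S)) : Prop :=
  (∀ A ∈ B, MeasurableSet A) ∧ IsDonsker Q ((fun A : Set S => A.indicator (fun _ => (1 : ℝ))) '' B)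

/-! ### Empirical quantities attached to a sample `s = ((x₁, y₁), …, (xₙ, yₙ))` -/

/-- `Q_n(r)`: proportion of the sample whose feature lies in `r`. -/
def empMass {d n : ℕ} (s : Fin n → (Fin d → ℝ) × ℝ) (r : Set (Fin d → ℝ)) : ℝ :=
  (∑ i, r.indicator (fun _ => (1 : ℝ)) (s i).1) / n

/-- `E_n[Y]`. -/
def empMean {d n : ℕ} (s : Fin n → (Fin d → ℝ) × ℝ) : ℝ :=
  (∑ i, (s i).2) / n

/-- `E_n[h(Y) | X ∈ r]` (meaningful when `Q_n(r) > 0`). -/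
def empCondExp {d n : ℕ} (s : Fin n → (Fin d → ℝ) × ℝ) (h : ℝ → ℝ) (r : Set (Fin d → ℝ)) : ℝ :=
  (∑ i, h (s i).2 * r.indicator (fun _ => (1 : ℝ)) (s i).1) /
    ∑ i, r.indicator (fun _ => (1 : ℝ)) (s i).1

/-- `V_n(Y | X ∈ r)`. -/
def empCondVar {d n : ℕ} (s : Fin n → (Fin d → ℝ) × ℝ) (r : Set (Fin d → ℝ)) : ℝ :=
  empCondExp s (fun y => y ^ 2) r - empCondExp s (fun y => y) r ^ 2

/-! ### Redundancy -/

/-- `#φ_C(x)`: the number of sets of `C` containing `x`. -/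
def activation {E : Type*} (C : Set (Set E)) (x : E) : ℕ := {r | r ∈ C ∧ x ∈ r}.ncard

/-- Maximal redundancy: maximum of `#φ_C` over the union of `C` (`0` if that union is empty). -/
def maxRedundancy {E : Type*} (C : Set (Set E)) : ℕ := sSup (activation C '' ⋃₀ C)

/-- Minimal redundancy: minimum of `#φ_C` over the union of `C` (`0` if that union is empty). -/
def minRedundancy {E : Type*} (C : Set (Set E)) : ℕ := sInf (activation C '' ⋃₀ C)

/-! ### Significant and insignificant sets -/

/-- Significant sets of `C` for the sample `s`, with parameter `β` and variance estimate `σ2`. -/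
def significant {d n : ℕ} (s : Fin n → (Fin d → ℝ) × ℝ) (β σ2 : ℝ)
    (C : Finset (Set (Fin d → ℝ))) : Set (Set (Fin d → ℝ)) :=
  {r | r ∈ C ∧
    Real.sqrt (max (empCondVar s r - σ2) 0) ≤ β * |empCondExp s (fun y => y) r - empMean s|}

/-- Insignificant sets of `C` for the sample `s`. -/
def insignificant {d n : ℕ} (s : Fin n → (Fin d → ℝ) × ℝ) (β ε σ2 : ℝ)
    (C : Finset (Set (Fin d → ℝ))) : Set (Set (Fin d → ℝ)) :=
  {r | r ∈ C ∧ r ∉ significant s β σ2 C ∧ Real.sqrt (max (empCondVar s r - σ2) 0) ≤ ε}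

/-! ### Suitable sequences -/

/-- The sample `((X₁, Y₁), …, (Xₙ, Yₙ))` formed by the first `n` observations. -/
def sample {Ω S : Type*} (D : ℕ → Ω → S) (n : ℕ) (ω : Ω) : Fin n → S := fun i => D i ω

/-- `U_n = o_P(1)`; for a non-measurable `U_n`, `μ` of a set is its outer probability. -/
def IsLittleOP {Ω : Type*} [MeasurableSpace Ω] (μ : Measure Ω) (U : ℕ → Ω → ℝ) : Prop :=
  TendstoInMeasure μ U atTop (fun _ => 0)

/-- Set coverage condition: almost surely `Q_n(r) > n^{-α}` for all `r ∈ C_n`. The index `n = 1`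
is left out since `Q_1(r) > 1` never holds. -/
def SetCoverage {Ω : Type*} [MeasurableSpace Ω] {d : ℕ} (μ : Measure Ω)
    (D : ℕ → Ω → (Fin d → ℝ) × ℝ) (α : ℝ)
    (C : ∀ n : ℕ, (Fin n → (Fin d → ℝ) × ℝ) → Finset (Set (Fin d → ℝ))) : Prop :=
  ∀ n : ℕ, 2 ≤ n → ∀ᵐ ω ∂μ, ∀ r ∈ C n (sample D n ω),
    (n : ℝ) ^ (-α) < empMass (sample D n ω) r

/-- The sequence `C` of data-dependent finite collections of sets is `α`-suitable, the noise
variance `σ2` being estimated by `σn`. A relation `U_n = o_P(b_n⁻² ∧ n^{1/2-α})` is written as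
`U_n · (b_n² ∨ n^{α-1/2}) = o_P(1)`. -/
structure IsSuitable {Ω : Type*} [MeasurableSpace Ω] {d : ℕ} (μ : Measure Ω)
    (D : ℕ → Ω → (Fin d → ℝ) × ℝ) (σ2 α : ℝ)
    (C : ∀ n : ℕ, (Fin n → (Fin d → ℝ) × ℝ) → Finset (Set (Fin d → ℝ)))
    (σn : ∀ n : ℕ, (Fin n → (Fin d → ℝ) × ℝ) → ℝ) : Prop where
  set_coverage : SetCoverage μ D α C
  collection_coverage : IsLittleOP μ fun n ω =>
    empMass (sample D n ω) (⋃ r ∈ C n (sample D n ω), r)ᶜ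
  estimator_measurable : ∀ n, Measurable (σn n)
  estimator_consistent : IsLittleOP μ fun n ω => σn n (sample D n ω) - σ2
  significance_redundancy : ∃ β ε : ℕ → Ω → ℝ,
    (∀ n, Measurable (β n)) ∧ (∀ n, Measurable (ε n)) ∧ IsLittleOP μ β ∧ IsLittleOP μ ε ∧
    (∀ n : ℕ, 1 ≤ n → ∀ᵐ ω ∂μ,
      (C n (sample D n ω) : Set (Set (Fin d → ℝ))) =
        significant (sample D n ω) (β n ω) (σn n (sample D n ω)) (C n (sample D n ω)) ∪
        insignificant (sample D n ω) (β n ω) (ε n ω) (σn n (sample D n ω))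
          (C n (sample D n ω))) ∧
    (IsLittleOP μ fun n ω =>
      let Cs := significant (sample D n ω) (β n ω) (σn n (sample D n ω)) (C n (sample D n ω))
      ((maxRedundancy Cs : ℝ) / minRedundancy Cs) * max (β n ω ^ 2) ((n : ℝ) ^ (α - 1 / 2))) ∧
    (IsLittleOP μ fun n ω =>
      let Ci := insignificant (sample D n ω) (β n ω) (ε n ω) (σn n (sample D n ω))
        (C n (sample D n ω))
      ((maxRedundancy Ci : ℝ) / minRedundancy Ci) * max (ε n ω ^ 2) ((n : ℝ) ^ (α - 1 / 2)))

/-- Largest diameter, in `[0, ∞]` and for the norm `N`, of a set of the collection `C`. -/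
def maxDiam {d : ℕ} (N : Seminorm ℝ (Fin d → ℝ)) (C : Finset (Set (Fin d → ℝ))) : ℝ≥0∞ :=
  ⨆ r ∈ C, ⨆ x ∈ r, ⨆ y ∈ r, ENNReal.ofReal (N (x - y))

end QuasiCovering

end

open QuasiCovering

open QuasiCovering

/-! ### Donsker classes of sets: uniform tightness of the empirical process -/

namespace QuasiCovering

/-! The redundancy of a partition is 1, so everything rests on showing that, uniformly over the
cells, `V_n(Y | X ∈ r)` exceeds `σ²` by at most `o_P(1)` (`tendsto_measure_empCondVar_excess`). A
measurable majorant of the square roots of these excesses then serves as `ε_n`, and every cell that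
is not significant is insignificant.

The variance over a cell is at most the mean of `(Y - g(x₀))²` for any `x₀` in it. Since `g` is
uniformly continuous and diameters vanish, this is close to the cell mean of `Z²`.

The difficulty is to compare the cell mean of `Z²` with `σ²` for cells chosen from the data, when
only the cylinders `r × ℝ` are Donsker. As `Y` is bounded and `Z` is independent of `X`, the noise
is bounded, so `Z²` takes finitely many levels up to an error `w`. By independence, the features
whose noise lies in a given level form an i.i.d. sample of random size; hence their counts deviate
by `O(√n)` uniformly over the class (`IsDonskerSets.exists_deviation_bound`,
`measure_marked_deviation_le`). Summing over levels and using the law of large numbers for `Z²`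
leaves an error of order `√n` (`empCondVar_le_of_deviations`), negligible against the more than
`n^{1-α}` points of a cell because `α < 1/2`. -/

/-- If the outer expectation of a nonnegative map is small, so is the outer probability that this
map is at least one. -/
lemma measure_one_le_le_of_outerExp_lt {Ω : Type*} [MeasurableSpace Ω] (μ : Measure Ω)
    [IsProbabilityMeasure μ] {T : Ω → ℝ} (hT0 : ∀ ω, 0 ≤ T ω) (hT1 : ∀ ω, T ω ≤ 1) {c : ℝ}
    (h : outerExp μ T < c) : μ {ω | 1 ≤ T ω} ≤ ENNReal.ofReal c := by
  unfold outerExp at h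
  have hne : {x : ℝ | ∃ U : Ω → ℝ, Measurable U ∧ Integrable U μ ∧ (∀ ω, T ω ≤ U ω) ∧
      x = ∫ ω, U ω ∂μ}.Nonempty :=
    ⟨1, fun _ => 1, measurable_const, integrable_const _, hT1, by simp⟩
  obtain ⟨x, ⟨U, hUm, hUi, hTU, rfl⟩, hx⟩ := exists_lt_of_csInf_lt hne h
  have h1 := mul_meas_ge_le_integral_of_nonneg
    (ae_of_all μ fun ω => (hT0 ω).trans (hTU ω)) hUi 1
  rw [one_mul] at h1
  calc μ {ω | 1 ≤ T ω} ≤ μ {ω | 1 ≤ U ω} := measure_mono fun ω (hω : 1 ≤ T ω) => hω.trans (hTU ω)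
    _ = ENNReal.ofReal (μ.real {ω | 1 ≤ U ω}) := by simp
    _ ≤ ENNReal.ofReal c := ENNReal.ofReal_le_ofReal (h1.trans hx.le)

/-- A trivial bound for the finitely many sample sizes that a limit theorem does not control. -/
lemma abs_sum_indicator_sub_le {S : Type*} [MeasurableSpace S] (Q : Measure S)
    [IsProbabilityMeasure Q] (n : ℕ) (s : Fin n → S) (A : Set S) :
    |∑ i, A.indicator (fun _ => (1 : ℝ)) (s i) - n * Q.real A| ≤ n := by
  have h0 : 0 ≤ ∑ i, A.indicator (fun _ => (1 : ℝ)) (s i) :=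
    Finset.sum_nonneg fun i _ => indicator_nonneg (fun _ _ => zero_le_one) _
  have h1 : ∑ i, A.indicator (fun _ => (1 : ℝ)) (s i) ≤ n := by
    calc ∑ i, A.indicator (fun _ => (1 : ℝ)) (s i) ≤ ∑ _i : Fin n, (1 : ℝ) :=
          Finset.sum_le_sum fun i _ => indicator_le_self' (fun _ _ => zero_le_one) _
      _ = n := by simp
  have h2 : (n : ℝ) * Q.real A ≤ n := mul_le_of_le_one_right n.cast_nonneg measureReal_le_one
  have h3 : 0 ≤ (n : ℝ) * Q.real A := by positivity
  rw [abs_le]; constructor <;> linarith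

lemma abs_sum_indicator_sub_eq {S : Type*} [MeasurableSpace S] (Q : Measure S) (n : ℕ)
    (s : Fin n → S) {A : Set S} (hA : MeasurableSet A) :
    |∑ i, A.indicator (fun _ => (1 : ℝ)) (s i) - n * Q.real A| =
      Real.sqrt n * abs (empProcess Q n s (A.indicator fun _ => (1 : ℝ))) := by
  rcases Nat.eq_zero_or_pos n with rfl | hn
  · simp
  have hn' : (0 : ℝ) < n := by exact_mod_cast hn
  unfold empProcess
  rw [abs_mul, ← mul_assoc, abs_of_nonneg (Real.sqrt_nonneg _), Real.mul_self_sqrt hn'.le]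
  conv_rhs => rw [← abs_of_nonneg hn'.le, ← abs_mul, abs_of_nonneg hn'.le]
  congr 1
  rw [integral_indicator_const _ hA, mul_sub, mul_div_cancel₀ _ hn'.ne']
  simp

/-- Deviations of the empirical measure of a Donsker class of sets are uniformly of order `√n`,
in outer probability. -/
theorem IsDonskerSets.exists_deviation_bound {S : Type*} [MeasurableSpace S] {Q : Measure S}
    [IsProbabilityMeasure Q] {B : Set (Set S)} (h : IsDonskerSets Q B) {δ : ℝ} (hδ : 0 < δ) :
    ∃ M : ℝ, 0 ≤ M ∧ ∀ n : ℕ, (Measure.pi fun _ : Fin n => Q)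
      {s | ∃ A ∈ B, M * Real.sqrt n <
        |∑ i, A.indicator (fun _ => (1 : ℝ)) (s i) - n * Q.real A|} ≤ ENNReal.ofReal δ := by
  obtain ⟨hB, -, v, hv, ν, hν, htight, hlim⟩ := h
  obtain ⟨K, hK, hνK⟩ := htight (ENNReal.ofReal (δ / 2)) (by simpa using hδ)
  obtain ⟨R, hR⟩ := hK.isBounded.exists_norm_le
  -- A cutoff that vanishes on the ball of radius `R`, hence on `K`, and equals 1 where the norm is
  -- at least `R + 1`.
  have hcont : Continuous fun z : EllInf ((fun A : Set S => A.indicator (fun _ => (1 : ℝ))) '' B) =>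
      min 1 (max 0 (‖z‖ - R)) := by fun_prop
  let f : EllInf ((fun A : Set S => A.indicator (fun _ => (1 : ℝ))) '' B) →ᵇ ℝ :=
    BoundedContinuousFunction.ofNormedAddCommGroup _ hcont 1 fun z => by
      rw [Real.norm_eq_abs, abs_of_nonneg (le_min zero_le_one (le_max_left _ _))]
      exact min_le_left _ _
  have hf : ∀ z, f z = min 1 (max 0 (‖z‖ - R)) := fun z => rfl
  have hint : ∫ z, f z ∂ν ≤ δ / 2 := by
    have hKm : MeasurableSet Kᶜ := hK.isClosed.measurableSet.compl
    calc ∫ z, f z ∂ν ≤ ∫ z, Kᶜ.indicator (fun _ => (1 : ℝ)) z ∂ν := by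
          refine integral_mono (f.integrable ν) ((integrable_const _).indicator hKm) fun z => ?_
          by_cases hz : z ∈ K
          · have := hR z hz
            simp [hf, hz, this]
          · simp [hf, hz]
      _ = ν.real Kᶜ := by rw [integral_indicator_const _ hKm]; simp
      _ ≤ δ / 2 := ENNReal.toReal_le_of_le_ofReal (by positivity) hνK
  have hev : ∀ᶠ n : ℕ in atTop,
      outerExp (Measure.pi fun _ : Fin n => Q) (fun s => f (v n s)) < δ :=
    (hlim f).eventually_lt_const (by linarith)
  obtain ⟨n₀, hn₀⟩ := eventually_atTop.1 hev
  -- The term `√n₀` serves the indices `n < n₀`, where the deviation is at most `n ≤ √n₀ · √n`.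
  refine ⟨max (R + 1) (Real.sqrt n₀), (Real.sqrt_nonneg _).trans (le_max_right _ _), fun n => ?_⟩
  rcases lt_or_ge n n₀ with hn | hn
  · refine (measure_mono_null ?_ measure_empty).trans_le zero_le
    rintro s ⟨A, hA, hlt⟩
    have h1 := abs_sum_indicator_sub_le Q n s A
    have h2 : (n : ℝ) ≤ Real.sqrt n₀ * Real.sqrt n := by
      calc (n : ℝ) = Real.sqrt n * Real.sqrt n := (Real.mul_self_sqrt n.cast_nonneg).symm
        _ ≤ _ := by gcongr
    have h3 : Real.sqrt n₀ * Real.sqrt n ≤ max (R + 1) (Real.sqrt n₀) * Real.sqrt n := by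
      gcongr; exact le_max_right _ _
    exact absurd hlt (by linarith)
  · refine (measure_mono ?_).trans (measure_one_le_le_of_outerExp_lt _ (T := fun s => f (v n s))
      (fun s => le_min zero_le_one (le_max_left _ _)) (fun s => min_le_left _ _) (hn₀ n hn))
    rintro s ⟨A, hA, hlt⟩
    rw [abs_sum_indicator_sub_eq Q n s (hB A hA), mul_comm] at hlt
    have h1 := lt_of_mul_lt_mul_left hlt (Real.sqrt_nonneg _)
    have h2 : abs (empProcess Q n s (A.indicator fun _ => (1 : ℝ))) ≤ ‖v n s‖ := by
      have := lp.norm_apply_le_norm ENNReal.top_ne_zero (v n s) ⟨_, mem_image_of_mem _ hA⟩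
      rwa [Real.norm_eq_abs, hv] at this
    have h3 : R + 1 ≤ ‖v n s‖ := ((le_max_left _ _).trans h1.le).trans h2
    change 1 ≤ f (v n s)
    rw [hf]
    exact le_min le_rfl (le_max_of_le_right (by linarith))

/-! ### Independent marks and random subsamples -/

lemma measurePreserving_pi_precomp {α ι κ : Type*} [MeasurableSpace α] [Fintype ι] [Fintype κ]
    (p : Measure α) [IsProbabilityMeasure p] {e : κ → ι} (he : Function.Injective e) :
    MeasurePreserving (fun (x : ι → α) (j : κ) => x (e j)) (Measure.pi fun _ => p)
      (Measure.pi fun _ => p) := by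
  refine ⟨by fun_prop, ?_⟩
  have h := (iIndepFun_pi (μ := fun _ : ι => p) (X := fun _ x => x)
    (fun i => aemeasurable_id)).precomp he
  rw [iIndepFun_iff_map_fun_eq_pi_map (fun i => (measurable_pi_apply (e i)).aemeasurable)] at h
  refine h.trans ?_
  congr 1
  ext1 j
  exact (measurePreserving_eval (fun _ : ι => p) (e j)).map_eq

/-- Outer probabilities of events on the first components of a sample of pairs. -/
lemma pi_eq_pi_prod_fst {α β : Type*} [MeasurableSpace α] [MeasurableSpace β] (p : Measure α)
    (q : Measure β) [IsProbabilityMeasure p] [IsProbabilityMeasure q] (n : ℕ)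
    (E : Set (Fin n → α)) :
    (Measure.pi fun _ : Fin n => p) E =
      (Measure.pi fun _ : Fin n => p.prod q) {s | (fun i => (s i).1) ∈ E} := by
  have h := (measurePreserving_arrowProdEquivProdArrow α β (Fin n) (fun _ => p)
    (fun _ => q)).measure_preimage_equiv (E ×ˢ univ)
  -- The product formula for rectangles needs no measurability, so `E` may be arbitrary.
  rw [Measure.prod_prod, measure_univ, mul_one] at h
  rw [← h]
  congr 1
  ext s
  simp [MeasurableEquiv.arrowProdEquivProdArrow, Equiv.arrowProdEquivProdArrow]

open Classical in
/-- The subsample of the first components selected by means of the (independent) second components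
behaves like an i.i.d. sample of random size. -/
lemma measure_subsample_le {α β : Type*} [MeasurableSpace α] [MeasurableSpace β] (p : Measure α)
    (q : Measure β) [IsProbabilityMeasure p] [IsProbabilityMeasure q] {B : Set β}
    (hB : MeasurableSet B) (E : ∀ m : ℕ, Set (Fin m → α)) {δ : ℝ≥0∞}
    (hE : ∀ m, (Measure.pi fun _ : Fin m => p) (E m) ≤ δ) (n : ℕ) :
    (Measure.pi fun _ : Fin n => p.prod q)
      {s | (fun j => (s ((Finset.univ.filter fun i => (s i).2 ∈ B).orderEmbOfFin rfl j)).1) ∈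
        E (Finset.univ.filter fun i => (s i).2 ∈ B).card} ≤ δ := by
  let I : (Fin n → β) → Finset (Fin n) := fun z => Finset.univ.filter fun i => z i ∈ B
  -- Measurable hulls keep the outer probabilities of the `E m` and make `V` measurable, so that
  -- Fubini applies.
  let W : Finset (Fin n) → Set (Fin n → α) := fun J =>
    {x | (fun j => x (J.orderEmbOfFin rfl j)) ∈ toMeasurable (Measure.pi fun _ => p) (E J.card)}
  let V : Set ((Fin n → α) × (Fin n → β)) := ⋃ J : Finset (Fin n), W J ×ˢ {z | I z = J}
  have hI : ∀ J, MeasurableSet {z | I z = J} := by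
    intro J
    have : {z | I z = J} = ⋂ i, {z : Fin n → β | z i ∈ B ↔ i ∈ J} := by
      ext z; simp [I, Finset.ext_iff]
    rw [this]
    refine MeasurableSet.iInter fun i => ?_
    have hi : MeasurableSet {z : Fin n → β | z i ∈ B} := (measurable_pi_apply i) hB
    by_cases hJ : i ∈ J
    · simpa [hJ] using hi
    · simp only [hJ, iff_false]
      exact hi.compl
  have hpre : ∀ J : Finset (Fin n), MeasurePreserving
      (fun (x : Fin n → α) (j : Fin J.card) => x (J.orderEmbOfFin rfl j))
      (Measure.pi fun _ => p) (Measure.pi fun _ => p) := fun J =>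
    measurePreserving_pi_precomp p (J.orderEmbOfFin rfl).injective
  have hW : ∀ J, MeasurableSet (W J) := fun J =>
    (hpre J).measurable (measurableSet_toMeasurable _ _)
  have hV : MeasurableSet V := MeasurableSet.iUnion fun J => (hW J).prod (hI J)
  have hWδ : ∀ J, (Measure.pi fun _ : Fin n => p) (W J) ≤ δ := fun J => by
    have := (hpre J).measure_preimage
      (measurableSet_toMeasurable (Measure.pi fun _ => p) (E J.card)).nullMeasurableSet
    refine this.trans_le ?_
    rw [measure_toMeasurable]
    exact hE _
  have hVδ : ((Measure.pi fun _ : Fin n => p).prod (Measure.pi fun _ : Fin n => q)) V ≤ δ := by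
    -- Once the marks are fixed, so is the index set, and the selected features are i.i.d. with law
    -- `p`.
    rw [Measure.prod_apply_symm hV]
    calc ∫⁻ z, (Measure.pi fun _ : Fin n => p) ((fun x => (x, z)) ⁻¹' V)
            ∂(Measure.pi fun _ : Fin n => q) ≤ ∫⁻ _z, δ ∂(Measure.pi fun _ : Fin n => q) := by
          refine lintegral_mono fun z => (measure_mono ?_).trans (hWδ (I z))
          intro x hx
          simp only [V, mem_preimage, mem_iUnion, mem_prod, mem_ofPred_eq] at hx
          obtain ⟨J, hJ, rfl⟩ := hx
          exact hJ
      _ = δ := by simp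
  rw [← (measurePreserving_arrowProdEquivProdArrow α β (Fin n) (fun _ => p)
    (fun _ => q)).measure_preimage_equiv V] at hVδ
  refine (measure_mono fun s hs => ?_).trans hVδ
  exact mem_iUnion.2 ⟨I fun i => (s i).2, subset_toMeasurable _ _ hs, rfl⟩

open Classical in
/-- Uniform deviations of the counts of a class of sets over the subsample selected by independent
marks. -/
lemma measure_marked_deviation_le {α β : Type*} [MeasurableSpace α] [MeasurableSpace β]
    (p : Measure α) (q : Measure β) [IsProbabilityMeasure p] [IsProbabilityMeasure q] {B : Set β}
    (hB : MeasurableSet B) (R : Set (Set α)) {M : ℝ} (hM : 0 ≤ M) {δ : ℝ≥0∞}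
    (hR : ∀ m : ℕ, (Measure.pi fun _ : Fin m => p) {x | ∃ r ∈ R, M * Real.sqrt m <
        |∑ i, r.indicator (fun _ => (1 : ℝ)) (x i) - m * p.real r|} ≤ δ) (n : ℕ) :
    (Measure.pi fun _ : Fin n => p.prod q) {s | ∃ r ∈ R, M * Real.sqrt n <
      |∑ i with (s i).2 ∈ B, r.indicator (fun _ => (1 : ℝ)) (s i).1 -
        (Finset.univ.filter fun i => (s i).2 ∈ B).card * p.real r|} ≤ δ := by
  refine (measure_mono ?_).trans (measure_subsample_le p q hB _ hR n)
  rintro s ⟨r, hr, hlt⟩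
  refine ⟨r, hr, ?_⟩
  set J := Finset.univ.filter fun i => (s i).2 ∈ B with hJ
  have hsum : ∑ j, r.indicator (fun _ => (1 : ℝ)) (s (J.orderEmbOfFin rfl j)).1 =
      ∑ i ∈ J, r.indicator (fun _ => (1 : ℝ)) (s i).1 := by
    conv_rhs => rw [← Finset.map_orderEmbOfFin_univ J rfl, Finset.sum_map]
    rfl
  rw [hsum]
  -- At most `n` indices are selected, so the radius of the subsample is at most `M √n`.
  refine lt_of_le_of_lt ?_ hlt
  gcongr
  simpa using J.card_le_univ

/-! ### The additive noise model -/

section Regression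

variable {α : Type*} [MeasurableSpace α] {Q : Measure (α × ℝ)} [IsProbabilityMeasure Q]
  {g : α → ℝ}

/-- Joint law of the feature and of the noise. -/
lemma map_fst_noise (hg : Measurable g)
    (hind : IndepFun (fun p : α × ℝ => p.2 - g p.1) Prod.fst Q) :
    Q.map (fun p => (p.1, p.2 - g p.1)) =
      (Q.map Prod.fst).prod (Q.map fun p => p.2 - g p.1) :=
  (indepFun_iff_map_prod_eq_prod_map_map (by fun_prop) (by fun_prop)).1 hind.symm

/-- A noise which is independent of the feature is bounded if the response is. -/
lemma exists_noise_bound (hg : Measurable g)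
    (hind : IndepFun (fun p : α × ℝ => p.2 - g p.1) Prod.fst Q)
    {L : ℝ} (hY : ∀ᵐ p ∂Q, |p.2| ≤ L) : ∃ b : ℝ, 0 ≤ b ∧ ∀ᵐ p ∂Q, |p.2 - g p.1| ≤ b := by
  have hX : IsProbabilityMeasure (Q.map (Prod.fst : α × ℝ → α)) :=
    Measure.isProbabilityMeasure_map (by fun_prop)
  have h1 : ∀ᵐ u ∂(Q.map (Prod.fst : α × ℝ → α)).prod (Q.map fun p => p.2 - g p.1),
      |u.2 + g u.1| ≤ L := by
    rw [← map_fst_noise hg hind, ae_map_iff (by fun_prop)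
      (measurableSet_le (by fun_prop) measurable_const)]
    simpa using hY
  -- By Fubini, some fixed `x` satisfies `|Z + g x| ≤ L` almost surely; this bounds `Z`.
  obtain ⟨x, hx⟩ := (Measure.ae_ae_of_ae_prod h1).exists
  refine ⟨|L| + |g x|, by positivity, ?_⟩
  filter_upwards [ae_of_ae_map (by fun_prop) hx] with p hp
  calc |p.2 - g p.1| = |(p.2 - g p.1 + g x) - g x| := by ring_nf
    _ ≤ |p.2 - g p.1 + g x| + |g x| := abs_sub _ _
    _ ≤ |L| + |g x| := add_le_add_left (hp.trans (le_abs_self L)) _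

/-- Outer probabilities of events on the features of a sample. -/
lemma pi_map_fst_le (hg : Measurable g)
    (hind : IndepFun (fun p : α × ℝ => p.2 - g p.1) Prod.fst Q) (n : ℕ) (E : Set (Fin n → α)) :
    (Measure.pi fun _ : Fin n => Q.map Prod.fst) E ≤
      (Measure.pi fun _ : Fin n => Q) {s | (fun i => (s i).1) ∈ E} := by
  have hX : IsProbabilityMeasure (Q.map (Prod.fst : α × ℝ → α)) :=
    Measure.isProbabilityMeasure_map (by fun_prop)
  have hZ : IsProbabilityMeasure (Q.map fun p => p.2 - g p.1) :=
    Measure.isProbabilityMeasure_map (by fun_prop)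
  -- Preimages of non-measurable events can have smaller outer probability, so projecting `Q` gives
  -- the wrong inequality. Instead `Q` is written as the image under `T` of a product law, for which
  -- projection is exact, and `Measure.le_map_apply` goes the right way.
  let T : α × ℝ → α × ℝ := fun u => (u.1, u.2 + g u.1)
  have hT : Measurable T := by fun_prop
  have hQ : ((Q.map Prod.fst).prod (Q.map fun p => p.2 - g p.1)).map T = Q := by
    rw [← map_fst_noise hg hind, Measure.map_map hT (by fun_prop)]
    convert Measure.map_id
    ext p <;> simp [T]
  have hpi : (Measure.pi fun _ : Fin n => (Q.map Prod.fst).prod (Q.map fun p => p.2 - g p.1)).map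
      (fun u i => T (u i)) = Measure.pi fun _ : Fin n => Q := by
    have : IsProbabilityMeasure
        (((Q.map Prod.fst).prod (Q.map fun p => p.2 - g p.1)).map T) := by rwa [hQ]
    rw [Measure.pi_map_pi (fun _ => hT.aemeasurable), hQ]
  rw [pi_eq_pi_prod_fst _ (Q.map fun p => p.2 - g p.1), ← hpi]
  exact Measure.le_map_apply (f := fun (u : Fin n → α × ℝ) i => T (u i))
    (measurable_pi_lambda _ fun i => hT.comp (measurable_pi_apply i)).aemeasurable
    {s | (fun i => (s i).1) ∈ E}

/-- Deviation bound for the features, when the cylinders over a class of sets are Donsker. -/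
lemma exists_fst_deviation_bound (hg : Measurable g)
    (hind : IndepFun (fun p : α × ℝ => p.2 - g p.1) Prod.fst Q) {B : Set (Set (α × ℝ))}
    (hB : IsDonskerSets Q B) {δ : ℝ} (hδ : 0 < δ) :
    ∃ M : ℝ, 0 ≤ M ∧ ∀ m : ℕ, (Measure.pi fun _ : Fin m => Q.map Prod.fst)
      {x | ∃ r ∈ {r : Set α | r ×ˢ (univ : Set ℝ) ∈ B}, M * Real.sqrt m <
        |∑ i, r.indicator (fun _ => (1 : ℝ)) (x i) - m * (Q.map Prod.fst).real r|} ≤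
      ENNReal.ofReal δ := by
  obtain ⟨M, hM, h⟩ := hB.exists_deviation_bound hδ
  refine ⟨M, hM, fun m => (pi_map_fst_le hg hind m _).trans ((measure_mono ?_).trans (h m))⟩
  rintro s ⟨r, hr, hlt⟩
  refine ⟨_, hr, hlt.trans_eq ?_⟩
  have hrm : (Q.map Prod.fst).real r = Q.real (r ×ˢ (univ : Set ℝ)) := by
    rcases isEmpty_or_nonempty α with hα | hα
    · have : Q = 0 := by
        have : IsEmpty (α × ℝ) := inferInstance
        exact Measure.eq_zero_of_isEmpty Q
      simp [this]
    · have : MeasurableSet r := by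
        have := (hB.1 _ hr).preimage (measurable_prodMk_right (y := (0 : ℝ)))
        simpa using this
      rw [map_measureReal_apply measurable_fst this]
      congr 1
      ext; simp
  rw [hrm]
  congr 2
  refine Finset.sum_congr rfl fun i _ => ?_
  by_cases hi : (s i).1 ∈ r
  · rw [indicator_of_mem hi, indicator_of_mem (show s i ∈ r ×ˢ univ from ⟨hi, mem_univ _⟩)]
  · rw [indicator_of_notMem hi,
      indicator_of_notMem (fun h : s i ∈ r ×ˢ univ => hi h.1)]

end Regression

/-! ### Deterministic inequalities -/

/-- Sums weighted by squares, estimated by means of the counts of the levels of these squares. -/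
lemma sum_sq_mul_le_of_levels {n : ℕ} (z χ : Fin n → ℝ) (hχ : ∀ i, 0 ≤ χ i) {w : ℝ} (hw : 0 < w)
    {K : ℕ} (hK : ∀ i, z i ^ 2 < K * w) {q e : ℝ} (hq : 0 ≤ q) (he : 0 ≤ e)
    (hcount : ∀ k ∈ Finset.range K, ∑ i with ⌊z i ^ 2 / w⌋₊ = k, χ i ≤
      (Finset.univ.filter fun i => ⌊z i ^ 2 / w⌋₊ = k).card * q + e) :
    ∑ i, z i ^ 2 * χ i ≤ q * (∑ i, z i ^ 2 + n * w) + K ^ 2 * w * e := by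
  have hlow : ∀ i, (⌊z i ^ 2 / w⌋₊ : ℝ) * w ≤ z i ^ 2 := fun i =>
    (le_div_iff₀ hw).1 (Nat.floor_le (by positivity))
  have hup : ∀ i, z i ^ 2 ≤ (⌊z i ^ 2 / w⌋₊ + 1 : ℝ) * w := fun i =>
    ((div_lt_iff₀ hw).1 (Nat.lt_floor_add_one _)).le
  have hmaps : ∀ i ∈ (Finset.univ : Finset (Fin n)), ⌊z i ^ 2 / w⌋₊ ∈ Finset.range K := by
    intro i _
    rw [Finset.mem_range, Nat.floor_lt (by positivity), div_lt_iff₀ hw]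
    exact hK i
  -- Rounding a square up to `(k + 1) w` costs at most `w` per index. The errors `e` carry weights
  -- `(k + 1) w ≤ K w` for `k < K`, whence `K² w e`.
  calc ∑ i, z i ^ 2 * χ i
      ≤ ∑ i, ((⌊z i ^ 2 / w⌋₊ + 1 : ℝ) * w) * χ i :=
        Finset.sum_le_sum fun i _ => mul_le_mul_of_nonneg_right (hup i) (hχ i)
    _ = ∑ k ∈ Finset.range K, ∑ i with ⌊z i ^ 2 / w⌋₊ = k,
          ((⌊z i ^ 2 / w⌋₊ + 1 : ℝ) * w) * χ i := (Finset.sum_fiberwise_of_maps_to hmaps _).symm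
    _ = ∑ k ∈ Finset.range K, ((k + 1 : ℝ) * w) * ∑ i with ⌊z i ^ 2 / w⌋₊ = k, χ i := by
        refine Finset.sum_congr rfl fun k _ => ?_
        rw [Finset.mul_sum]
        exact Finset.sum_congr rfl fun i hi => by rw [(Finset.mem_filter.1 hi).2]
    _ ≤ ∑ k ∈ Finset.range K, ((k + 1 : ℝ) * w) *
          ((Finset.univ.filter fun i => ⌊z i ^ 2 / w⌋₊ = k).card * q + e) :=
        Finset.sum_le_sum fun k hk => mul_le_mul_of_nonneg_left (hcount k hk) (by positivity)
    _ = q * (∑ k ∈ Finset.range K, ∑ i with ⌊z i ^ 2 / w⌋₊ = k,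
          ((⌊z i ^ 2 / w⌋₊ + 1 : ℝ) * w)) + ∑ k ∈ Finset.range K, ((k + 1 : ℝ) * w) * e := by
        rw [Finset.mul_sum, ← Finset.sum_add_distrib]
        refine Finset.sum_congr rfl fun k _ => ?_
        rw [Finset.sum_congr rfl fun i hi => by rw [(Finset.mem_filter.1 hi).2],
          Finset.sum_const, nsmul_eq_mul]
        ring
    _ = q * (∑ i, ((⌊z i ^ 2 / w⌋₊ + 1 : ℝ) * w)) +
          ∑ k ∈ Finset.range K, ((k + 1 : ℝ) * w) * e := by
        rw [Finset.sum_fiberwise_of_maps_to hmaps]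
    _ ≤ q * (∑ i, (z i ^ 2 + w)) + ∑ _k ∈ Finset.range K, ((K : ℝ) * w) * e := by
        gcongr with i _ k hk
        · linarith [hlow i]
        · exact_mod_cast Finset.mem_range.1 hk
    _ = q * (∑ i, z i ^ 2 + n * w) + K ^ 2 * w * e := by
        simp [Finset.sum_add_distrib]
        ring

section Sample

variable {d n : ℕ} (s : Fin n → (Fin d → ℝ) × ℝ) (r : Set (Fin d → ℝ))

/-- The conditional empirical variance is at most the conditional empirical quadratic risk of any
constant. -/
lemma empCondVar_le_sum_sq_sub (c : ℝ)
    (hT : 0 < ∑ i, r.indicator (fun _ => (1 : ℝ)) (s i).1) :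
    empCondVar s r ≤ (∑ i, ((s i).2 - c) ^ 2 * r.indicator (fun _ => (1 : ℝ)) (s i).1) /
      ∑ i, r.indicator (fun _ => (1 : ℝ)) (s i).1 := by
  unfold empCondVar empCondExp
  set T := ∑ i, r.indicator (fun _ => (1 : ℝ)) (s i).1 with hTdef
  have h : ∑ i, ((s i).2 - c) ^ 2 * r.indicator (fun _ => (1 : ℝ)) (s i).1 =
      ∑ i, (s i).2 ^ 2 * r.indicator (fun _ => (1 : ℝ)) (s i).1 -
        2 * c * ∑ i, (s i).2 * r.indicator (fun _ => (1 : ℝ)) (s i).1 + c ^ 2 * T := by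
    rw [hTdef, Finset.mul_sum, Finset.mul_sum, ← Finset.sum_sub_distrib, ← Finset.sum_add_distrib]
    exact Finset.sum_congr rfl fun i _ => by ring
  rw [h, add_div, sub_div, mul_div_cancel_right₀ _ hT.ne', mul_div_assoc]
  nlinarith [sq_nonneg ((∑ i, (s i).2 * r.indicator (fun _ => (1 : ℝ)) (s i).1) / T - c)]

lemma empCondVar_le_sq {L : ℝ} (hL : ∀ i, |(s i).2| ≤ L) : empCondVar s r ≤ L ^ 2 := by
  have h0 : 0 ≤ ∑ i, r.indicator (fun _ => (1 : ℝ)) (s i).1 :=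
    Finset.sum_nonneg fun i _ => indicator_nonneg (fun _ _ => zero_le_one) _
  rcases h0.eq_or_lt with h | h
  · simp only [empCondVar, empCondExp, ← h, div_zero]
    nlinarith [sq_nonneg L]
  · refine (empCondVar_le_sum_sq_sub s r 0 h).trans ?_
    rw [div_le_iff₀ h, Finset.mul_sum]
    refine Finset.sum_le_sum fun i _ =>
      mul_le_mul_of_nonneg_right ?_ (indicator_nonneg (fun _ _ => zero_le_one) _)
    rw [sub_zero]
    exact sq_le_sq' (abs_le.1 (hL i)).1 (abs_le.1 (hL i)).2

/-- Bound for the conditional empirical variance over a cell on which the regression function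
oscillates little, in terms of the deviations of the marked counts of this cell. -/
lemma empCondVar_le_of_deviations {g : (Fin d → ℝ) → ℝ} {α b τ v w q M : ℝ} {K : ℕ}
    (hn : 0 < n) (hw : 0 < w) (hq : 0 ≤ q) (hM : 0 ≤ M) (hv : 0 ≤ v)
    (hb : ∀ i, |(s i).2 - g (s i).1| ≤ b) (hK : b ^ 2 < K * w)
    (hosc : ∀ x ∈ r, ∀ y ∈ r, |g x - g y| ≤ τ)
    (hmass : (n : ℝ) ^ (-α) < empMass s r)
    (hsq : ∑ i, ((s i).2 - g (s i).1) ^ 2 ≤ n * v)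
    (hdev : |∑ i, r.indicator (fun _ => (1 : ℝ)) (s i).1 - n * q| ≤ M * Real.sqrt n)
    (hcount : ∀ k ∈ Finset.range K,
      |∑ i with ⌊((s i).2 - g (s i).1) ^ 2 / w⌋₊ = k, r.indicator (fun _ => (1 : ℝ)) (s i).1 -
      (Finset.univ.filter fun i => ⌊((s i).2 - g (s i).1) ^ 2 / w⌋₊ = k).card * q| ≤
      M * Real.sqrt n) :
    empCondVar s r ≤ v + w + M * (v + w + K ^ 2 * w) * (n : ℝ) ^ (α - 1 / 2) +
      (2 * b * τ + τ ^ 2) := by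
  have hn' : (0 : ℝ) < n := by exact_mod_cast hn
  have hχ : ∀ i, 0 ≤ r.indicator (fun _ => (1 : ℝ)) (s i).1 := fun i =>
    indicator_nonneg (fun _ _ => zero_le_one) _
  unfold empMass at hmass
  have hTn := (lt_div_iff₀ hn').1 hmass
  set T := ∑ i, r.indicator (fun _ => (1 : ℝ)) (s i).1 with hTdef
  have hT : 0 < T := lt_trans (by positivity) hTn
  -- Set coverage gives `T > n^{1-α}`: relative to the cell count, `√n` is of order `n^{α-1/2}`.
  have hsqrt : Real.sqrt n ≤ (n : ℝ) ^ (α - 1 / 2) * T := by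
    calc Real.sqrt n = (n : ℝ) ^ (α - 1 / 2) * ((n : ℝ) ^ (-α) * n) := by
          rw [← mul_assoc, ← Real.rpow_add hn', ← Real.rpow_add_one hn'.ne', Real.sqrt_eq_rpow]
          ring_nf
      _ ≤ _ := by gcongr
  obtain ⟨i₀, -, hi₀⟩ := Finset.exists_ne_zero_of_sum_ne_zero hT.ne'
  have hx₀ : (s i₀).1 ∈ r := by
    by_contra h
    exact hi₀ (indicator_of_notMem h _)
  -- Centring at `g(x₀)`, for a sample point `x₀` of the cell, splits `Y - g(x₀)` into the noise and
  -- an oscillation of size at most `τ`.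
  refine (empCondVar_le_sum_sq_sub s r (g (s i₀).1) hT).trans ?_
  rw [div_le_iff₀ hT]
  have hb0 : 0 ≤ b := (abs_nonneg _).trans (hb i₀)
  have hZ := sum_sq_mul_le_of_levels (fun i => (s i).2 - g (s i).1)
    (fun i => r.indicator (fun _ => (1 : ℝ)) (s i).1) hχ hw
    (fun i => (sq_le_sq' (abs_le.1 (hb i)).1 (abs_le.1 (hb i)).2).trans_lt hK) hq
    (mul_nonneg hM (Real.sqrt_nonneg n)) (fun k hk => by linarith [(abs_le.1 (hcount k hk)).2])
  have hterm : ∀ i, ((s i).2 - g (s i₀).1) ^ 2 * r.indicator (fun _ => (1 : ℝ)) (s i).1 ≤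
      ((s i).2 - g (s i).1) ^ 2 * r.indicator (fun _ => (1 : ℝ)) (s i).1 +
        (2 * b * τ + τ ^ 2) * r.indicator (fun _ => (1 : ℝ)) (s i).1 := by
    intro i
    by_cases hi : (s i).1 ∈ r
    · have h1 := hosc _ hi _ hx₀
      have h2 : |((s i).2 - g (s i).1) * (g (s i).1 - g (s i₀).1)| ≤ b * τ := by
        rw [abs_mul]; gcongr; exact hb i
      have h3 : (g (s i).1 - g (s i₀).1) ^ 2 ≤ τ ^ 2 :=
        sq_le_sq' (abs_le.1 h1).1 (abs_le.1 h1).2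
      simp only [indicator_of_mem hi, mul_one]
      nlinarith [(abs_le.1 h2).2]
    · simp [indicator_of_notMem hi]
  have hsum := Finset.sum_le_sum fun i (_ : i ∈ Finset.univ) => hterm i
  rw [Finset.sum_add_distrib, ← Finset.mul_sum, ← hTdef] at hsum
  have hnq : n * q ≤ T + M * Real.sqrt n := by linarith [(abs_le.1 hdev).1]
  have h4 : q * (∑ i, ((s i).2 - g (s i).1) ^ 2 + n * w) ≤ (T + M * Real.sqrt n) * (v + w) := by
    calc q * (∑ i, ((s i).2 - g (s i).1) ^ 2 + n * w) ≤ q * (n * v + n * w) := by gcongr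
      _ = (n * q) * (v + w) := by ring
      _ ≤ _ := by gcongr
  have h5 : M * (v + w + K ^ 2 * w) * Real.sqrt n ≤
      M * (v + w + K ^ 2 * w) * ((n : ℝ) ^ (α - 1 / 2) * T) := by gcongr
  calc _ ≤ _ := hsum
    _ ≤ (T + M * Real.sqrt n) * (v + w) + K ^ 2 * w * (M * Real.sqrt n) +
        (2 * b * τ + τ ^ 2) * T := by linarith
    _ ≤ _ := by linarith

end Sample

/-! ### Norms, rates and laws of the sample -/

/-- A norm on `ℝ^d` dominates a multiple of the supremum norm. -/
lemma exists_pos_mul_norm_le {d : ℕ} (N : Seminorm ℝ (Fin d → ℝ)) (hN : ∀ x, N x = 0 → x = 0) :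
    ∃ c : ℝ, 0 < c ∧ ∀ x, c * ‖x‖ ≤ N x := by
  have hcont : Continuous N := by
    have h : ContinuousOn N univ := N.convexOn.continuousOn isOpen_univ
    exact continuousOn_univ.1 h
  -- The unit sphere is empty when `d = 0`.
  rcases (Metric.sphere (0 : Fin d → ℝ) 1).eq_empty_or_nonempty with he | hne
  · refine ⟨1, one_pos, fun x => ?_⟩
    have hx : x = 0 := by
      by_contra hx
      have : ‖x‖⁻¹ • x ∈ Metric.sphere (0 : Fin d → ℝ) 1 := by
        simp [norm_smul, norm_ne_zero_iff.2 hx]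
      simp [he] at this
    simp [hx]
  · obtain ⟨y, hy, hmin⟩ := (isCompact_sphere (0 : Fin d → ℝ) 1).exists_isMinOn hne
      hcont.continuousOn
    have hy1 : ‖y‖ = 1 := by simpa using hy
    refine ⟨N y, lt_of_le_of_ne (apply_nonneg N y) fun h => ?_, fun x => ?_⟩
    · rw [hN y h.symm, norm_zero] at hy1
      exact zero_ne_one hy1
    · rcases eq_or_ne x 0 with rfl | hx
      · simp
      · have hx' : 0 < ‖x‖ := norm_pos_iff.2 hx
        have h1 : N y ≤ N (‖x‖⁻¹ • x) := hmin (by simp [norm_smul, hx'.ne'])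
        rw [map_smul_eq_mul, norm_inv, norm_norm, inv_mul_eq_div, le_div_iff₀ hx'] at h1
        exact h1

lemma lt_of_maxDiam_lt {d : ℕ} {N : Seminorm ℝ (Fin d → ℝ)} {C : Finset (Set (Fin d → ℝ))} {c : ℝ}
    (hc : maxDiam N C < ENNReal.ofReal c) {r : Set (Fin d → ℝ)} (hr : r ∈ C) {x y : Fin d → ℝ}
    (hx : x ∈ r) (hy : y ∈ r) : N (x - y) < c := by
  have h : ENNReal.ofReal (N (x - y)) ≤ maxDiam N C :=
    le_iSup₂_of_le r hr (le_iSup₂_of_le x hx (le_iSup₂_of_le y hy le_rfl))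
  exact (ENNReal.ofReal_lt_ofReal_iff_of_nonneg (apply_nonneg N _)).1 (h.trans_lt hc)

lemma tendsto_natCast_rpow_sub_half {α : ℝ} (hα : α < 1 / 2) :
    Tendsto (fun n : ℕ => (n : ℝ) ^ (α - 1 / 2)) atTop (𝓝 0) := by
  have h := (tendsto_rpow_neg_atTop (show 0 < 1 / 2 - α by linarith)).comp
    tendsto_natCast_atTop_atTop
  rwa [neg_sub] at h

/-- The weak law of large numbers. -/
lemma tendsto_measure_mean_deviation {Ω S : Type*} [MeasurableSpace Ω] [MeasurableSpace S]
    {μ : Measure Ω} [IsProbabilityMeasure μ] {Q : Measure S} {D : ℕ → Ω → S}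
    (hDmeas : ∀ i, Measurable (D i)) (hDlaw : ∀ i, μ.map (D i) = Q) (hDindep : iIndepFun D μ)
    {f : S → ℝ} (hf : Measurable f) (hfi : Integrable f Q) {η : ℝ} (hη : 0 < η) :
    Tendsto (fun n : ℕ => μ {ω | η ≤ |(∑ i : Fin n, f (D i ω)) / n - ∫ z, f z ∂Q|}) atTop
      (𝓝 0) := by
  have hident : ∀ i, IdentDistrib (fun ω => f (D i ω)) (fun ω => f (D 0 ω)) μ μ := fun i =>
    (IdentDistrib.mk (hDmeas i).aemeasurable (hDmeas 0).aemeasurable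
      ((hDlaw i).trans (hDlaw 0).symm)).comp hf
  have hint : Integrable (fun ω => f (D 0 ω)) μ := by
    have := hfi
    rw [← hDlaw 0, integrable_map_measure hf.aestronglyMeasurable (hDmeas 0).aemeasurable] at this
    exact this
  have hmean : ∫ ω, f (D 0 ω) ∂μ = ∫ z, f z ∂Q := by
    rw [← hDlaw 0, integral_map (hDmeas 0).aemeasurable hf.aestronglyMeasurable]
  have h := strong_law_ae_real (fun i ω => f (D i ω)) hint
    (fun i j hij => (hDindep.indepFun hij).comp hf hf) hident
  rw [hmean] at h
  have hm := tendstoInMeasure_of_tendsto_ae (fun n => Measurable.aestronglyMeasurable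
    (by exact (Finset.measurable_sum _ fun i _ => hf.comp (hDmeas i)).div_const _)) h
  have := tendstoInMeasure_iff_norm.1 hm η hη
  refine this.congr fun n => ?_
  simp only [Finset.sum_range, Real.norm_eq_abs]

/-- This lets the noises play the role of independent marks on the features in
`measure_marked_deviation_le`. -/
lemma map_sample_noise {Ω α : Type*} [MeasurableSpace Ω] [MeasurableSpace α]
    {μ : Measure Ω} [IsProbabilityMeasure μ] {Q : Measure (α × ℝ)} [IsProbabilityMeasure Q]
    {D : ℕ → Ω → α × ℝ} (hDmeas : ∀ i, Measurable (D i)) (hDlaw : ∀ i, μ.map (D i) = Q)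
    (hDindep : iIndepFun D μ) {g : α → ℝ} (hg : Measurable g)
    (hind : IndepFun (fun p : α × ℝ => p.2 - g p.1) Prod.fst Q) (n : ℕ) :
    μ.map (fun ω (i : Fin n) => ((D i ω).1, (D i ω).2 - g (D i ω).1)) =
      Measure.pi fun _ : Fin n => (Q.map Prod.fst).prod (Q.map fun p => p.2 - g p.1) := by
  have hF : Measurable fun p : α × ℝ => (p.1, p.2 - g p.1) := by fun_prop
  have h : iIndepFun (fun (i : Fin n) ω => ((D i ω).1, (D i ω).2 - g (D i ω).1)) μ :=
    (hDindep.comp (fun _ p => (p.1, p.2 - g p.1)) fun _ => hF).precomp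
      (Fin.val_injective (n := n))
  have hm : ∀ i : Fin n, AEMeasurable (fun ω => ((D i ω).1, (D i ω).2 - g (D i ω).1)) μ :=
    fun i => (hF.comp (hDmeas i)).aemeasurable
  refine ((iIndepFun_iff_map_fun_eq_pi_map hm).1 h).trans ?_
  congr 1
  ext1 i
  rw [← map_fst_noise hg hind, ← hDlaw i, Measure.map_map hF (hDmeas i)]
  rfl

/-! ### Uniform control of the excess variance -/

/-- The conditional empirical variances over the cells of a data-dependent partition with vanishing
diameter do not exceed the variance of the noise, asymptotically and uniformly. -/
theorem tendsto_measure_empCondVar_excess {Ω : Type*} [MeasurableSpace Ω] {μ : Measure Ω}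
    [IsProbabilityMeasure μ] {d : ℕ} {N : Seminorm ℝ (Fin d → ℝ)} (hN : ∀ x, N x = 0 → x = 0)
    {Q : Measure ((Fin d → ℝ) × ℝ)} [IsProbabilityMeasure Q] {D : ℕ → Ω → (Fin d → ℝ) × ℝ}
    (hDmeas : ∀ i, Measurable (D i)) (hDlaw : ∀ i, μ.map (D i) = Q) (hDindep : iIndepFun D μ)
    {g : (Fin d → ℝ) → ℝ} (hg : Measurable g) {σ2 : ℝ}
    (hZL2 : MemLp (fun p : (Fin d → ℝ) × ℝ => p.2 - g p.1) 2 Q)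
    (hZmean : ∫ p, (p.2 - g p.1) ∂Q = 0)
    (hZvar : variance (fun p : (Fin d → ℝ) × ℝ => p.2 - g p.1) Q = σ2)
    (hZindep : IndepFun (fun p : (Fin d → ℝ) × ℝ => p.2 - g p.1) Prod.fst Q)
    {L : ℝ} (hY : ∀ᵐ p ∂Q, |p.2| ≤ L) {𝒳 : Set (Fin d → ℝ)} (hguc : UniformContinuousOn g 𝒳)
    {α : ℝ} (hα : α < 1 / 2)
    {C : ∀ n : ℕ, (Fin n → (Fin d → ℝ) × ℝ) → Finset (Set (Fin d → ℝ))}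
    (hC : ∀ n s, ∀ r ∈ C n s, r ⊆ 𝒳) (hcov : SetCoverage μ D α C)
    {B : Set (Set ((Fin d → ℝ) × ℝ))} (hB : IsDonskerSets Q B)
    (hCB : ∀ n : ℕ, 1 ≤ n → ∀ᵐ ω ∂μ, ∀ r ∈ C n (sample D n ω), r ×ˢ (univ : Set ℝ) ∈ B)
    (hdiam : ∀ δ : ℝ≥0∞, 0 < δ →
      Tendsto (fun n => μ {ω | δ ≤ maxDiam N (C n (sample D n ω))}) atTop (𝓝 0))
    {η : ℝ} (hη : 0 < η) :
    Tendsto (fun n => μ {ω | ∃ r ∈ C n (sample D n ω), σ2 + η < empCondVar (sample D n ω) r})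
      atTop (𝓝 0) := by
  classical
  obtain ⟨b, hb0, hb⟩ := exists_noise_bound hg hZindep hY
  have hσ : ∫ p, (p.2 - g p.1) ^ 2 ∂Q = σ2 := by
    rw [← hZvar, variance_of_integral_eq_zero (by fun_prop) hZmean]
  have hσ0 : 0 ≤ σ2 := hZvar ▸ variance_nonneg _ _
  have hlaw := map_sample_noise hDmeas hDlaw hDindep hg hZindep
  have hX : IsProbabilityMeasure (Q.map (Prod.fst : (Fin d → ℝ) × ℝ → Fin d → ℝ)) :=
    Measure.isProbabilityMeasure_map (by fun_prop)
  have hZ : IsProbabilityMeasure (Q.map fun p : (Fin d → ℝ) × ℝ => p.2 - g p.1) :=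
    Measure.isProbabilityMeasure_map (by fun_prop)
  obtain ⟨c, hc0, hc⟩ := exists_pos_mul_norm_le N hN
  -- Four errors share `η`: law of large numbers, rounding to levels, counting deviations, and
  -- oscillation of `g`.
  set w := η / 4 with hw
  have hw0 : 0 < w := by positivity
  obtain ⟨K, hK⟩ := exists_nat_gt (b ^ 2 / w)
  rw [div_lt_iff₀ hw0] at hK
  set τ := min 1 (w / (2 * b + 1)) with hτ
  have hτ0 : 0 < τ := by positivity
  have hτw : 2 * b * τ + τ ^ 2 ≤ w := by
    have h1 : τ * (2 * b + 1) ≤ w := (le_div_iff₀ (by positivity)).1 (min_le_right _ _)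
    have h2 : τ ≤ 1 := min_le_left _ _
    nlinarith
  obtain ⟨ρ, hρ0, hρ⟩ := Metric.uniformContinuousOn_iff.1 hguc τ hτ0
  rw [ENNReal.tendsto_nhds_zero]
  intro δ hδ
  -- There are `K + 3` bad events: one per noise level, one for the total counts, one for the law of
  -- large numbers, one for the diameters.
  obtain ⟨δ', hδ'0, hδ'⟩ : ∃ δ' : ℝ, 0 < δ' ∧ (K + 3 : ℝ≥0∞) * ENNReal.ofReal δ' ≤ δ := by
    have hne : ENNReal.ofReal (min δ.toReal 1) ≠ 0 ∨ δ = ⊤ := by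
      rcases eq_or_ne δ ⊤ with h | h
      · exact Or.inr h
      · exact Or.inl (by simpa using ENNReal.toReal_pos hδ.ne' h)
    rcases hne with h | h
    · have hm : 0 < min δ.toReal 1 := by simpa using h
      refine ⟨min δ.toReal 1 / (K + 3), by positivity, ?_⟩
      rw [show (K + 3 : ℝ≥0∞) = ENNReal.ofReal (K + 3) by
        rw [ENNReal.ofReal_add (by positivity) (by positivity)]; simp,
        ← ENNReal.ofReal_mul (by positivity), mul_div_cancel₀ _ (by positivity)]
      exact (ENNReal.ofReal_le_ofReal (min_le_left _ _)).trans ENNReal.ofReal_toReal_le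
    · exact ⟨1, one_pos, h ▸ le_top⟩
  obtain ⟨M, hM0, hM⟩ := exists_fst_deviation_bound hg hZindep hB hδ'0
  let R : Set (Set (Fin d → ℝ)) := {r | r ×ˢ (univ : Set ℝ) ∈ B}
  let bad (n : ℕ) (A : Set ℝ) : Set Ω := {ω | ∃ r ∈ R, M * Real.sqrt n <
    |∑ i with (sample D n ω i).2 - g (sample D n ω i).1 ∈ A,
        r.indicator (fun _ => (1 : ℝ)) (sample D n ω i).1 -
      (Finset.univ.filter fun i => (sample D n ω i).2 - g (sample D n ω i).1 ∈ A).card *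
        (Q.map Prod.fst).real r|}
  have hbad : ∀ (n : ℕ) (A : Set ℝ), MeasurableSet A → μ (bad n A) ≤ ENNReal.ofReal δ' := by
    intro n A hA
    have h1 := measure_marked_deviation_le _ (Q.map fun p : (Fin d → ℝ) × ℝ => p.2 - g p.1) hA R
      hM0 hM n
    rw [← hlaw n] at h1
    have hm : Measurable fun ω (i : Fin n) => ((D i ω).1, (D i ω).2 - g (D i ω).1) :=
      measurable_pi_lambda _ fun i => by have := hDmeas i; fun_prop
    exact (Measure.le_map_apply hm.aemeasurable _).trans h1
  have hlevel : ∀ k : ℕ, MeasurableSet {t : ℝ | ⌊t ^ 2 / w⌋₊ = k} := fun k =>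
    (Nat.measurable_floor.comp (by fun_prop : Measurable fun t : ℝ => t ^ 2 / w))
      (measurableSet_singleton k)
  have hLLN := tendsto_measure_mean_deviation hDmeas hDlaw hDindep
    (f := fun p => (p.2 - g p.1) ^ 2) (by fun_prop) hZL2.integrable_sq hw0
  rw [hσ] at hLLN
  have hrate : Tendsto (fun n : ℕ => M * (σ2 + w + w + K ^ 2 * w) * (n : ℝ) ^ (α - 1 / 2)) atTop
      (𝓝 0) := by
    simpa using (tendsto_natCast_rpow_sub_half hα).const_mul (M * (σ2 + w + w + K ^ 2 * w))
  have hδ0 : 0 < ENNReal.ofReal δ' := by simpa using hδ'0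
  filter_upwards [ENNReal.tendsto_nhds_zero.1 hLLN _ hδ0,
    ENNReal.tendsto_nhds_zero.1 (hdiam (ENNReal.ofReal (c * ρ)) (by simp; positivity)) _ hδ0,
    hrate.eventually_lt_const hw0, eventually_ge_atTop 2] with n hn1 hn2 hn3 hn4
  have hball : ∀ᵐ ω ∂μ, ∀ i : Fin n, |(D i ω).2 - g (D i ω).1| ≤ b := by
    rw [ae_all_iff]
    intro i
    have := hb
    rw [← hDlaw i] at this
    exact ae_of_ae_map (hDmeas i).aemeasurable this
  have hae : ∀ᵐ ω ∂μ, (∀ i : Fin n, |(D i ω).2 - g (D i ω).1| ≤ b) ∧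
      (∀ r ∈ C n (sample D n ω), r ×ˢ (univ : Set ℝ) ∈ B) ∧
      ∀ r ∈ C n (sample D n ω), (n : ℝ) ^ (-α) < empMass (sample D n ω) r := by
    filter_upwards [hball, hCB n (by omega), hcov n hn4] with ω h1 h2 h3 using ⟨h1, h2, h3⟩
  have hn0 : (0 : ℝ) < n := by exact_mod_cast (by omega : 0 < n)
  set U : Set Ω := (⋃ k ∈ Finset.range K, bad n {t : ℝ | ⌊t ^ 2 / w⌋₊ = k}) ∪
    (bad n univ ∪ ({ω | w ≤ |(∑ i : Fin n, ((D i ω).2 - g (D i ω).1) ^ 2) / n - σ2|} ∪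
      {ω | ENNReal.ofReal (c * ρ) ≤ maxDiam N (C n (sample D n ω))})) with hU
  have hμU : μ U ≤ δ := by
    refine le_trans ?_ hδ'
    calc μ U ≤ (∑ k ∈ Finset.range K, ENNReal.ofReal δ') + (ENNReal.ofReal δ' +
          (ENNReal.ofReal δ' + ENNReal.ofReal δ')) := by
          refine (measure_union_le _ _).trans (add_le_add ?_ ?_)
          · exact (measure_biUnion_finset_le _ _).trans
              (Finset.sum_le_sum fun k _ => hbad n _ (hlevel k))
          · refine (measure_union_le _ _).trans (add_le_add (hbad n _ MeasurableSet.univ) ?_)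
            exact (measure_union_le _ _).trans (add_le_add hn1 hn2)
      _ = (K + 3 : ℝ≥0∞) * ENNReal.ofReal δ' := by
          rw [Finset.sum_const, Finset.card_range, nsmul_eq_mul]
          ring
  refine (measure_mono_ae ?_).trans hμU
  filter_upwards [hae] with ω ⟨h1, h2, h3⟩ hω
  obtain ⟨r, hr, hlt⟩ := hω
  change ω ∈ U
  by_contra hωU
  simp only [hU, mem_union, mem_iUnion, not_or, not_exists] at hωU
  obtain ⟨hω1, hω2, hω3, hω4⟩ := hωU
  rw [mem_ofPred_eq, not_le] at hω3 hω4
  have hdev : ∀ A : Set ℝ, ω ∉ bad n A →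
      |∑ i with (sample D n ω i).2 - g (sample D n ω i).1 ∈ A,
        r.indicator (fun _ => (1 : ℝ)) (sample D n ω i).1 -
      (Finset.univ.filter fun i => (sample D n ω i).2 - g (sample D n ω i).1 ∈ A).card *
        (Q.map Prod.fst).real r| ≤ M * Real.sqrt n := fun A hA =>
    not_lt.1 fun hlt => hA ⟨r, h2 r hr, hlt⟩
  have hsq : ∑ i : Fin n, ((D i ω).2 - g (D i ω).1) ^ 2 ≤ n * (σ2 + w) := by
    have h4 := (abs_lt.1 hω3).2
    have h5 : (∑ i : Fin n, ((D i ω).2 - g (D i ω).1) ^ 2) / n ≤ σ2 + w := by linarith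
    rwa [div_le_iff₀' hn0] at h5
  have hosc : ∀ x ∈ r, ∀ y ∈ r, |g x - g y| ≤ τ := by
    intro x hx y hy
    have h4 := (hc (x - y)).trans_lt (lt_of_maxDiam_lt hω4 hr hx hy)
    have h5 := lt_of_mul_lt_mul_left h4 hc0.le
    rw [← dist_eq_norm] at h5
    exact (hρ x (hC _ _ _ hr hx) y (hC _ _ _ hr hy) h5).le
  have hfin := empCondVar_le_of_deviations (sample D n ω) r (by omega) hw0
    (measureReal_nonneg (μ := Q.map Prod.fst) (s := r)) hM0 (by positivity : 0 ≤ σ2 + w) h1 hK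
    hosc (h3 r hr) hsq (by
      simpa only [mem_univ, Finset.filter_true, Finset.card_univ, Fintype.card_fin]
        using hdev univ hω2)
    (fun k hk => by
      convert hdev _ (hω1 k hk) <;> simp only [mem_ofPred_eq])
  have : w + w + w + w = η := by rw [hw]; ring
  linarith

/-! ### Measurable majorants, redundancy and `o_P` calculus -/

/-- Random sets of reals which are bounded, and bounded from above by any positive constant with
outer probability tending to one, have measurable upper bounds that vanish in probability. -/
lemma exists_measurable_isLittleOP_bound {Ω : Type*} [MeasurableSpace Ω] {μ : Measure Ω}
    [IsProbabilityMeasure μ] {V : ℕ → Ω → Set ℝ} {c : ℝ} (hc : 0 ≤ c)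
    (hV : ∀ᵐ ω ∂μ, ∀ n, ∀ v ∈ V n ω, v ≤ c)
    (hlim : ∀ η : ℝ, 0 < η → Tendsto (fun n => μ {ω | ∃ v ∈ V n ω, η < v}) atTop (𝓝 0)) :
    ∃ ε : ℕ → Ω → ℝ, (∀ n, Measurable (ε n)) ∧ IsLittleOP μ ε ∧
      ∀ᵐ ω ∂μ, ∀ n, ∀ v ∈ V n ω, v ≤ ε n ω := by
  classical
  -- Each `t n k` bounds `V n` almost surely: by `c` on a measurable hull of the event that
  -- `1/(k+1)` is exceeded, by `1/(k+1)` off it. The infimum over `k` remains a bound and tends to 0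
  -- in probability.
  let H (n k : ℕ) : Set Ω := toMeasurable μ {ω | ∃ v ∈ V n ω, 1 / ((k : ℝ) + 1) < v}
  let t (n k : ℕ) (ω : Ω) : ℝ := if ω ∈ H n k then c else 1 / ((k : ℝ) + 1)
  have ht0 : ∀ n k ω, 0 ≤ t n k ω := fun n k ω => by
    simp only [t]; split_ifs <;> positivity
  have hbdd : ∀ n ω, BddBelow (range fun k => t n k ω) := fun n ω =>
    ⟨0, by rintro _ ⟨k, rfl⟩; exact ht0 n k ω⟩
  refine ⟨fun n ω => ⨅ k, t n k ω, fun n => Measurable.iInf fun k =>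
    Measurable.ite (measurableSet_toMeasurable _ _) measurable_const measurable_const, ?_, ?_⟩
  · refine tendstoInMeasure_iff_norm.2 fun η hη => ?_
    obtain ⟨k, hk⟩ := exists_nat_one_div_lt hη
    refine tendsto_of_tendsto_of_tendsto_of_le_of_le tendsto_const_nhds
      (hlim (1 / ((k : ℝ) + 1)) (by positivity)) (fun _ => zero_le) fun n => ?_
    rw [← measure_toMeasurable {ω | ∃ v ∈ V n ω, 1 / ((k : ℝ) + 1) < v}]
    refine measure_mono fun ω (hω : η ≤ ‖(⨅ k, t n k ω) - 0‖) => ?_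
    rw [sub_zero, Real.norm_eq_abs, abs_of_nonneg (le_ciInf fun k => ht0 n k ω)] at hω
    by_contra hωH
    have h1 : t n k ω = 1 / ((k : ℝ) + 1) := if_neg hωH
    linarith [ciInf_le (hbdd n ω) k]
  · filter_upwards [hV] with ω hω n v hv
    refine le_ciInf fun k => ?_
    by_cases hωH : ω ∈ H n k
    · exact (hω n v hv).trans_eq (if_pos hωH).symm
    · refine le_trans ?_ (if_neg hωH).symm.le
      exact not_lt.1 fun hlt => hωH (subset_toMeasurable _ _ ⟨v, hv, hlt⟩)

/-- The redundancy ratio of a family of cells of a partition is at most one. -/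
lemma redundancy_ratio_le_one {E : Type*} {𝒳 : Set E} (P : Finpartition 𝒳) {C : Set (Set E)}
    (hC : C ⊆ P.parts) : (maxRedundancy C : ℝ) / minRedundancy C ≤ 1 := by
  have h : activation C '' ⋃₀ C ⊆ {1} := by
    rintro _ ⟨x, ⟨r, hr, hx⟩, rfl⟩
    have : {r' | r' ∈ C ∧ x ∈ r'} = {r} := by
      ext r'
      refine ⟨fun h' => ?_, fun h' => h' ▸ ⟨hr, hx⟩⟩
      by_contra hne
      exact disjoint_left.1 (P.disjoint (hC h'.1) (hC hr) hne) h'.2 hx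
    simp [activation, this]
  unfold maxRedundancy minRedundancy
  -- For an empty union both redundancies are 0, and `0 / 0 = 0`.
  rcases subset_singleton_iff_eq.1 h with h | h <;> simp [h]

/-- For large `n` the deterministic term is below `η`, so the product can reach `η` only if `ε²`
does. -/
lemma isLittleOP_ratio_mul_max {Ω : Type*} [MeasurableSpace Ω] {μ : Measure Ω}
    {ε T : ℕ → Ω → ℝ} {α : ℝ} (hα : α < 1 / 2) (hε : IsLittleOP μ ε) (hT0 : ∀ n ω, 0 ≤ T n ω)
    (hT1 : ∀ n ω, T n ω ≤ 1) :
    IsLittleOP μ fun n ω => T n ω * max (ε n ω ^ 2) ((n : ℝ) ^ (α - 1 / 2)) := by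
  refine tendstoInMeasure_iff_norm.2 fun η hη => ?_
  refine tendsto_of_tendsto_of_tendsto_of_le_of_le' tendsto_const_nhds
    (tendstoInMeasure_iff_norm.1 hε (Real.sqrt η) (Real.sqrt_pos.2 hη))
    (Eventually.of_forall fun _ => zero_le) ?_
  filter_upwards [(tendsto_natCast_rpow_sub_half hα).eventually_lt_const hη] with n hn
  refine measure_mono fun ω hω => ?_
  simp only [mem_ofPred_eq, sub_zero, Real.norm_eq_abs] at hω ⊢
  have hm : 0 ≤ max (ε n ω ^ 2) ((n : ℝ) ^ (α - 1 / 2)) := le_max_of_le_left (sq_nonneg _)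
  rw [abs_of_nonneg (mul_nonneg (hT0 n ω) hm)] at hω
  have h1 := hω.trans (mul_le_of_le_one_left hm (hT1 n ω))
  refine Real.sqrt_le_iff.2 ⟨abs_nonneg _, ?_⟩
  rw [sq_abs]
  exact (le_max_iff.1 h1).resolve_right hn.not_ge

lemma isLittleOP_of_tendsto {Ω : Type*} [MeasurableSpace Ω] {μ : Measure Ω} {a : ℕ → ℝ}
    (ha : Tendsto a atTop (𝓝 0)) : IsLittleOP μ fun n _ => a n := by
  refine tendstoInMeasure_iff_norm.2 fun η hη => ?_
  refine tendsto_const_nhds.congr' ?_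
  filter_upwards [(tendsto_zero_iff_norm_tendsto_zero.1 ha).eventually_lt_const hη] with n hn
  simp only [sub_zero, hn.not_ge]
  exact measure_empty.symm

lemma IsLittleOP.max {Ω : Type*} [MeasurableSpace Ω] {μ : Measure Ω} {U V : ℕ → Ω → ℝ}
    (hU : IsLittleOP μ U) (hV : IsLittleOP μ V) : IsLittleOP μ fun n ω => max (U n ω) (V n ω) := by
  refine tendstoInMeasure_iff_norm.2 fun η hη => ?_
  have h := (tendstoInMeasure_iff_norm.1 hU η hη).add (tendstoInMeasure_iff_norm.1 hV η hη)
  rw [add_zero] at h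
  refine tendsto_of_tendsto_of_tendsto_of_le_of_le tendsto_const_nhds h (fun _ => zero_le)
    fun n => (measure_mono fun ω hω => ?_).trans (measure_union_le _ _)
  simp only [mem_union, mem_ofPred_eq, sub_zero, Real.norm_eq_abs] at hω ⊢
  exact le_max_iff.1 (hω.trans abs_max_le_max_abs_abs)

lemma isLittleOP_zero {Ω : Type*} [MeasurableSpace Ω] {μ : Measure Ω} :
    IsLittleOP μ fun _ _ => 0 :=
  isLittleOP_of_tendsto tendsto_const_nhds

end QuasiCovering

/-! ### Suitability of the partitions -/

theorem proposition5 {Ω : Type*} [MeasurableSpace Ω] (μ : Measure Ω) [IsProbabilityMeasure μ]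
    (d : ℕ)
    -- an arbitrary norm on `ℝ^d`, used to measure diameters
    (N : Seminorm ℝ (Fin d → ℝ)) (hN : ∀ x, N x = 0 → x = 0)
    -- the law `Q` of `(X, Y)` and an i.i.d. sequence of observations with that law
    (Q : Measure ((Fin d → ℝ) × ℝ)) [IsProbabilityMeasure Q]
    (D : ℕ → Ω → (Fin d → ℝ) × ℝ)
    (hDmeas : ∀ i, Measurable (D i)) (hDlaw : ∀ i, μ.map (D i) = Q) (hDindep : iIndepFun D μ)
    -- the regression model `Y = g(X) + Z`, with `Y` bounded and `Z` centred, independent of `X`,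
    -- of variance `σ2`
    (g : (Fin d → ℝ) → ℝ) (hg : Measurable g) (σ2 : ℝ)
    (hZL2 : MemLp (fun p : (Fin d → ℝ) × ℝ => p.2 - g p.1) 2 Q)
    (hZmean : ∫ p, (p.2 - g p.1) ∂Q = 0)
    (hZvar : variance (fun p : (Fin d → ℝ) × ℝ => p.2 - g p.1) Q = σ2)
    (hZindep : IndepFun (fun p : (Fin d → ℝ) × ℝ => p.2 - g p.1) Prod.fst Q)
    (hYbdd : ∃ L : ℝ, 0 < L ∧ ∀ᵐ p ∂Q, |p.2| ≤ L)
    -- the feature space, on which `g` is uniformly continuous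
    (𝒳 : Set (Fin d → ℝ)) (h𝒳meas : MeasurableSet 𝒳) (h𝒳 : ∀ᵐ p ∂Q, p.1 ∈ 𝒳)
    (hguc : UniformContinuousOn g 𝒳)
    (α : ℝ) (hα0 : 0 ≤ α) (hα1 : α < 1 / 2)
    -- data-dependent finite partitions of the feature space
    (P : ∀ n : ℕ, (Fin n → (Fin d → ℝ) × ℝ) → Finpartition 𝒳)
    (hcov : SetCoverage μ D α (fun n s => (P n s).parts))
    -- the cells obtained from an almost sure set of samples form a Donsker class
    (G : ∀ n : ℕ, Set (Fin n → (Fin d → ℝ) × ℝ))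
    (hG : ∀ n : ℕ, 1 ≤ n → ∀ᵐ ω ∂μ, sample D n ω ∈ G n)
    (hDonsker : IsDonskerSets Q
      {A | ∃ n : ℕ, 1 ≤ n ∧ ∃ s ∈ G n, ∃ r ∈ (P n s).parts, A = r ×ˢ (univ : Set ℝ)})
    -- the maximal diameter of a cell is `o_P(1)`
    (hdiam : ∀ δ : ℝ≥0∞, 0 < δ →
      Tendsto (fun n => μ {ω | δ ≤ maxDiam N (P n (sample D n ω)).parts}) atTop (𝓝 0)) :
    -- `σ2` being known, it is its own estimator
    IsSuitable μ D σ2 α (fun n s => (P n s).parts) (fun _ _ => σ2) := by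
  obtain ⟨L, hL0, hL⟩ := hYbdd
  have hσ0 : 0 ≤ σ2 := hZvar ▸ variance_nonneg _ _
  have hexcess : ∀ η : ℝ, 0 < η → Tendsto (fun n => μ {ω | ∃ r ∈ (P n (sample D n ω)).parts,
      σ2 + η < empCondVar (sample D n ω) r}) atTop (𝓝 0) := fun η hη =>
    tendsto_measure_empCondVar_excess hN hDmeas hDlaw hDindep hg hZL2 hZmean hZvar hZindep hL
      hguc hα1 (fun n s r hr => (P n s).le hr) hcov hDonsker
      (fun n hn => by
        filter_upwards [hG n hn] with ω hω r hr using ⟨n, hn, _, hω, r, hr, rfl⟩)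
      hdiam hη
  have hDae : ∀ {p : (Fin d → ℝ) × ℝ → Prop}, (∀ᵐ z ∂Q, p z) → ∀ᵐ ω ∂μ, ∀ i, p (D i ω) := by
    intro p hp
    refine ae_all_iff.2 fun i => ?_
    rw [← hDlaw i] at hp
    exact ae_of_ae_map (hDmeas i).aemeasurable hp
  obtain ⟨ε, hεm, hε0, hε⟩ := exists_measurable_isLittleOP_bound (μ := μ)
    (V := fun n ω => (fun r => Real.sqrt (max (empCondVar (sample D n ω) r - σ2) 0)) ''
      ((P n (sample D n ω)).parts : Set (Set (Fin d → ℝ)))) hL0.le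
    (by
      filter_upwards [hDae hL] with ω hω n v ⟨r, _, hv⟩
      rw [← hv]
      refine Real.sqrt_le_iff.2 ⟨hL0.le, max_le ?_ (sq_nonneg L)⟩
      linarith [empCondVar_le_sq (sample D n ω) r fun i => hω i])
    (by
      intro η hη
      refine tendsto_of_tendsto_of_tendsto_of_le_of_le tendsto_const_nhds
        (hexcess (η ^ 2) (by positivity)) (fun _ => zero_le) fun n => measure_mono ?_
      rintro ω ⟨_, ⟨r, hr, rfl⟩, hlt⟩
      refine ⟨r, hr, ?_⟩
      rw [Real.lt_sqrt hη.le, lt_max_iff] at hlt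
      have := hlt.resolve_right (sq_nonneg η).not_gt
      linarith)
  have hratio : ∀ (T : ∀ n, Ω → Set (Set (Fin d → ℝ))),
      (∀ n ω, T n ω ⊆ (P n (sample D n ω)).parts) → ∀ b : ℕ → Ω → ℝ, IsLittleOP μ b →
      IsLittleOP μ fun n ω => ((maxRedundancy (T n ω) : ℝ) / minRedundancy (T n ω)) *
        max (b n ω ^ 2) ((n : ℝ) ^ (α - 1 / 2)) := fun T hT b hb =>
    isLittleOP_ratio_mul_max hα1 hb (fun n ω => by positivity)
      fun n ω => redundancy_ratio_le_one _ (hT n ω)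
  have hβ : IsLittleOP μ fun (n : ℕ) _ => 1 / ((n : ℝ) + 1) :=
    isLittleOP_of_tendsto tendsto_one_div_add_atTop_nhds_zero_nat
  -- Any deterministic null sequence would do for `β`. The maximum with `1/(n+1)` keeps `ε`
  -- positive, so that `ε⁻²` makes sense.
  refine ⟨hcov, ?_, fun _ => measurable_const, ?_, fun n _ => 1 / ((n : ℝ) + 1),
    fun n ω => max (ε n ω) (1 / ((n : ℝ) + 1)), fun _ => measurable_const,
    fun n => (hεm n).max measurable_const, hβ, hε0.max hβ, fun n _ => ?_, ?_, ?_⟩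
  · refine isLittleOP_zero.congr_left fun n => ?_
    filter_upwards [hDae h𝒳] with ω hω
    have hU : (⋃ r ∈ (P n (sample D n ω)).parts, r) = 𝒳 := by
      have := (P n (sample D n ω)).sup_parts
      rwa [Finset.sup_id_set_eq_sUnion, sUnion_eq_biUnion] at this
    rw [hU]
    unfold empMass
    have h0 : ∀ i, 𝒳ᶜ.indicator (fun _ => (1 : ℝ)) (sample D n ω i).1 = 0 := fun i =>
      indicator_of_notMem (notMem_compl_iff.2 (hω i)) _
    simp [h0]
  · simpa using isLittleOP_zero
  · filter_upwards [hε] with ω hω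
    ext r
    refine ⟨fun hr => ?_, ?_⟩
    · by_cases hs : r ∈ significant (sample D n ω) (1 / ((n : ℝ) + 1)) σ2
          (P n (sample D n ω)).parts
      · exact Or.inl hs
      · exact Or.inr ⟨hr, hs, (hω n _ ⟨r, hr, rfl⟩).trans (le_max_left _ _)⟩
    · rintro (h | h) <;> exact h.1
  · exact hratio _ (fun n ω r hr => hr.1) _ hβ
  · exact hratio _ (fun n ω r hr => hr.1) _ (hε0.max hβ)
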